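/- Let $K$ be a field of characteristic zero (for instance $\mathbb{Q}$) and $n\ge 0$. Let $\mathsf{lie}_n$ and $\mathsf{ass}_n$ be the free Lie algebra and the free associative algebra over $K$ on $x_1,\dots,x_n$, with $\mathsf{lie}_n\subset\mathsf{ass}_n$ in the natural way; let $\mathsf{tr}_n=\mathsf{ass}_n/[\mathsf{ass}_n,\mathsf{ass}_n]$, where $[\mathsf{ass}_n,\mathsf{ass}_n]$ is the linear span of the commutators, with projection $|\cdot|:\mathsf{ass}_n\to\mathsf{tr}_n$; put $x_0=x_1+\cdots+x_n$. For $\tilde u=(u_1,\dots,u_n)\in\mathsf{lie}_n^{\oplus n}$ let $u=\rho(\tilde u)$ be the derivation of $\mathsf{lie}_n$ with $u(x_i)=[x_i,u_i]$ for $i=1,\dots,n$, and let $\mathrm{div}(\tilde u)=\sum_{i=1}^n|x_i(\partial_iu_i)|\in\mathsf{tr}_n$, where $\partial_1a,\dots,\partial_na\in\mathsf{ass}_n$ are determined by $a=\sum_{i=1}^n(\partial_ia)x_i$ for $a\in\mathsf{lie}_n$. Let $\mathsf{sder}_n$ be the set of those $\tilde u$ with $u(x_0)=0$, and let $\mathsf{krv}_n$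 be the set of those $\tilde u\in\mathsf{sder}_n$ for which there are formal power series $f_0,\dots,f_n\in K[[s]]$ with $\mathrm{div}(\tilde u)=\sum_{i=0}^n|f_i(x_i)|$ (an identity in the degree completion of $\mathsf{tr}_n$). Let $\mu^f_{\mathrm{gr}}:\mathsf{ass}_n\to\mathsf{ass}_n$ be the linear map given on words in the generators $a_1,\dots,a_m\in\{x_1,\dots,x_n\}$ by $$\mu^f_{\mathrm{gr}}(a_1\cdots a_m)=-\sum_{j=1}^{m-1}a_1\cdots a_{j-1}\,\mathfrak z(a_j,a_{j+1})\,a_{j+2}\cdots a_m,\qquad \mathfrak z(x_i,x_j)=\delta_{ij}x_i .$$ Proposition. Let $\tilde u\in\mathsf{sder}_n$, let $u=\rho(\tilde u)$, and suppose that there is some $c\in\mathsf{ass}_n$ such that $\mu^f_{\mathrm{gr}}(u(x_i))=[x_i,c]$ for all $i=1,\dots,n$. Then $\tilde u\in\mathsf{krv}_n$. -/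

import Mathlib

/-! # Tangential derivations, divergence and the Kashiwara-Vergne Lie algebras

`K` is the ground field, `n` the number of generators. -/

noncomputable section

namespace KV

/-! ## Derivations of a free Lie algebra with prescribed values on the generators -/

/-- The Lie algebra `L ⊗ K[ε]/(ε²)`: pairs `(a, b)`, to be read as `a + ε b`. -/
@[ext] structure Dual (L : Type*) where
  /-- the constant part -/
  fst : L
  /-- the coefficient of `ε` -/
  snd : L

namespace Dual

/-- Pairs, as a plain type. -/
def toProd (L : Type*) : Dual L ≃ L × L where
  toFun a := (a.fst, a.snd)
  invFun a := ⟨a.1, a.2⟩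
  left_inv _ := rfl
  right_inv _ := rfl

instance (L : Type*) [LieRing L] : AddCommGroup (Dual L) := (toProd L).addCommGroup

instance (K L : Type*) [CommRing K] [LieRing L] [LieAlgebra K L] : Module K (Dual L) :=
  (toProd L).module K

instance (L : Type*) [LieRing L] : Bracket (Dual L) (Dual L) where
  bracket a b := ⟨⁅a.fst, b.fst⁆, ⁅a.fst, b.snd⁆ + ⁅a.snd, b.fst⁆⟩

theorem fst_add {L : Type*} [LieRing L] (a b : Dual L) : (a + b).fst = a.fst + b.fst := rfl

theorem snd_add {L : Type*} [LieRing L] (a b : Dual L) : (a + b).snd = a.snd + b.snd := rfl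

theorem fst_zero {L : Type*} [LieRing L] : (0 : Dual L).fst = 0 := rfl

theorem snd_zero {L : Type*} [LieRing L] : (0 : Dual L).snd = 0 := rfl

theorem fst_smul {K L : Type*} [CommRing K] [LieRing L] [LieAlgebra K L] (t : K) (a : Dual L) :
    (t • a).fst = t • a.fst := rfl

theorem snd_smul {K L : Type*} [CommRing K] [LieRing L] [LieAlgebra K L] (t : K) (a : Dual L) :
    (t • a).snd = t • a.snd := rfl

theorem fst_lie {L : Type*} [LieRing L] (a b : Dual L) : ⁅a, b⁆.fst = ⁅a.fst, b.fst⁆ := rfl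

theorem snd_lie {L : Type*} [LieRing L] (a b : Dual L) :
    ⁅a, b⁆.snd = ⁅a.fst, b.snd⁆ + ⁅a.snd, b.fst⁆ := rfl

instance (L : Type*) [LieRing L] : LieRing (Dual L) where
  add_lie a b c := by
    ext <;> simp only [fst_add, snd_add, fst_lie, snd_lie, add_lie]
    abel
  lie_add a b c := by
    ext <;> simp only [fst_add, snd_add, fst_lie, snd_lie, lie_add]
    abel
  lie_self a := by
    ext
    · simp only [fst_lie, fst_zero, lie_self]
    · simp only [snd_lie, snd_zero]
      rw [← lie_skew a.fst a.snd, neg_add_cancel]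
  leibniz_lie a b c := by
    ext <;> simp only [fst_add, snd_add, fst_lie, snd_lie, lie_add, add_lie, lie_lie]
    · abel
    · abel

instance (K L : Type*) [CommRing K] [LieRing L] [LieAlgebra K L] : LieAlgebra K (Dual L) where
  lie_smul t a b := by
    ext <;> simp only [fst_smul, snd_smul, fst_lie, snd_lie, lie_smul, smul_add]

/-- The constant part, as a Lie algebra homomorphism. -/
def fstHom (K L : Type*) [CommRing K] [LieRing L] [LieAlgebra K L] : Dual L →ₗ⁅K⁆ L where
  toFun a := a.fst
  map_add' _ _ := rfl
  map_smul' _ _ := rfl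
  map_lie' := rfl

/-- The coefficient of `ε`, as a linear map. -/
def sndLin (K L : Type*) [CommRing K] [LieRing L] [LieAlgebra K L] : Dual L →ₗ[K] L where
  toFun a := a.snd
  map_add' _ _ := rfl
  map_smul' _ _ := rfl

end Dual

variable (K : Type*) [Field K] (n : ℕ)

/-- `lie_n`: the free Lie algebra on `x_1, …, x_n` (here indexed by `Fin n`). -/
abbrev Lie : Type _ := FreeLieAlgebra K (Fin n)

/-- `ass_n`: the free associative algebra on `x_1, …, x_n`. -/
abbrev Ass : Type _ := FreeAlgebra K (Fin n)

/-- The Lie homomorphism `a ↦ a + ε D a` attached to the derivation `D` with `D x_i = v_i`. -/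
def derHom (v : Fin n → Lie K n) : Lie K n →ₗ⁅K⁆ Dual (Lie K n) :=
  FreeLieAlgebra.lift K fun i => ⟨FreeLieAlgebra.of K i, v i⟩

theorem derHom_fst (v : Fin n → Lie K n) (a : Lie K n) : (derHom K n v a).fst = a := by
  have h : (Dual.fstHom K (Lie K n)).comp (derHom K n v) = LieHom.id := by
    ext i
    simp only [derHom, LieHom.comp_apply, FreeLieAlgebra.lift_of_apply]
    rfl
  exact LieHom.congr_fun h a

/-- The derivation `D` of `lie_n` with `D x_i = v_i` for all `i`. -/
def der (v : Fin n → Lie K n) : LieDerivation K (Lie K n) (Lie K n) where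
  toLinearMap := (Dual.sndLin K (Lie K n)).comp (derHom K n v : Lie K n →ₗ[K] Dual (Lie K n))
  leibniz' a b := by
    change (derHom K n v ⁅a, b⁆).snd = ⁅a, (derHom K n v b).snd⁆ - ⁅b, (derHom K n v a).snd⁆
    rw [LieHom.map_lie, Dual.snd_lie, derHom_fst, derHom_fst, sub_eq_add_neg, lie_skew]

theorem der_of (v : Fin n → Lie K n) (i : Fin n) : der K n v (FreeLieAlgebra.of K i) = v i := by
  change (derHom K n v (FreeLieAlgebra.of K i)).snd = v i
  simp [derHom]

/-- `tder_n`, the space of tangential derivations `ũ = (u_1, …, u_n)` with `u_i ∈ lie_n`. -/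
abbrev Tder : Type _ := Fin n → Lie K n

variable {K n}

/-- `ρ(ũ)`: the derivation of `lie_n` given by `x_i ↦ [x_i, u_i]`. -/
def rho (u : Tder K n) : LieDerivation K (Lie K n) (Lie K n) :=
  der K n fun i => ⁅FreeLieAlgebra.of K i, u i⁆

theorem rho_of (u : Tder K n) (i : Fin n) :
    rho u (FreeLieAlgebra.of K i) = ⁅FreeLieAlgebra.of K i, u i⁆ :=
  der_of K n _ i

variable (K n)

/-- `sder_n`: the tangential derivations with `ρ(ũ)(x_1 + ⋯ + x_n) = 0`. -/
def sder : Set (Tder K n) :=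
  {u | rho u (∑ i, FreeLieAlgebra.of K i) = 0}

/-! ## The free associative algebra -/

section
attribute [local instance] LieRing.ofAssociativeRing

/-- The natural Lie homomorphism `lie_n → ass_n` (commutator bracket on `ass_n`), `x_i ↦ x_i`. -/
def toAss : Lie K n →ₗ⁅K⁆ Ass K n := FreeLieAlgebra.lift K (FreeAlgebra.ι K)

end

variable {n}

/-- The generator `x_i` of `ass_n`. -/
abbrev x (i : Fin n) : Ass K n := FreeAlgebra.ι K i

/-- The word `x_{i_1} ⋯ x_{i_m}` of `ass_n`. -/
def word (l : List (Fin n)) : Ass K n := (l.map (x K)).prod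

variable {K}

/-- The linear map on `ass_n` with prescribed values on the basis of words. -/
def onWords {M : Type*} [AddCommGroup M] [Module K M] (f : List (Fin n) → M) : Ass K n →ₗ[K] M :=
  (FreeAlgebra.basisFreeMonoid K (Fin n)).constr K fun w => f w.toList

theorem basis_eq_word (w : FreeMonoid (Fin n)) :
    FreeAlgebra.basisFreeMonoid K (Fin n) w = word K w.toList := by
  simp [FreeAlgebra.basisFreeMonoid, FreeAlgebra.equivMonoidAlgebraFreeMonoid, word,
    FreeMonoid.lift_apply]

theorem onWords_word {M : Type*} [AddCommGroup M] [Module K M] (f : List (Fin n) → M)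
    (l : List (Fin n)) : onWords f (word K l) = f l := by
  have h := basis_eq_word (K := K) (FreeMonoid.ofList l)
  rw [FreeMonoid.toList_ofList] at h
  rw [← h, onWords, Module.Basis.constr_basis, FreeMonoid.toList_ofList]

theorem word_induction {P : Ass K n → Prop} (a : Ass K n) (hw : ∀ l, P (word K l)) (h0 : P 0)
    (hadd : ∀ a b, P a → P b → P (a + b)) (hsmul : ∀ (t : K) a, P a → P (t • a)) : P a := by
  have ha : a ∈ Submodule.span K (Set.range (FreeAlgebra.basisFreeMonoid K (Fin n))) := by
    rw [Module.Basis.span_eq]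
    trivial
  induction ha using Submodule.span_induction with
  | mem a h =>
    obtain ⟨w, rfl⟩ := h
    rw [basis_eq_word]
    exact hw _
  | zero => exact h0
  | add a b _ _ h1 h2 => exact hadd a b h1 h2
  | smul t a _ h => exact hsmul t a h

theorem word_mul (l m : List (Fin n)) : word K l * word K m = word K (l ++ m) := by
  simp [word]

/-- `∂_i`: removes a final letter `x_i` and kills the words that do not end in `x_i`, so that
`a = ∑ i, (∂_i a) x_i` for every `a` without constant term, in particular on `lie_n`. -/
def partialDeriv (i : Fin n) : Ass K n →ₗ[K] Ass K n :=
  onWords fun l => if l.getLast? = some i then word K l.dropLast else 0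

variable (K) in
/-- `𝔷(x_i, x_j) = δ_ij x_i`. -/
def frakz (i j : Fin n) : Ass K n := if i = j then x K i else 0

/-- `μ^f_gr`, of degree `-1`: on words,
`a_1 ⋯ a_m ↦ - ∑_{j=1}^{m-1} a_1 ⋯ a_{j-1} 𝔷(a_j, a_{j+1}) a_{j+2} ⋯ a_m`. -/
def muGr : Ass K n →ₗ[K] Ass K n :=
  onWords fun l => -∑ j : Fin (l.length - 1),
    word K (l.take j) * frakz K (l[j.1]'(by omega)) (l[j.1 + 1]'(by omega)) *
      word K (l.drop (j + 2))

/-! ## Cyclic words -/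

variable (K n)

/-- The linear span of all commutators in `ass_n`. -/
def commSpan : Submodule K (Ass K n) :=
  Submodule.span K {c | ∃ a b : Ass K n, c = a * b - b * a}

/-- `tr_n = ass_n / [ass_n, ass_n]`, the space of cyclic words. -/
abbrev Tr : Type _ := Ass K n ⧸ commSpan K n

variable {K n}

/-- The projection `| | : ass_n → tr_n`. -/
def tr : Ass K n →ₗ[K] Tr K n := (commSpan K n).mkQ

/-- The divergence `div(ũ) = ∑ i, |x_i (∂_i u_i)|`. -/
def divergence (u : Tder K n) : Tr K n :=
  ∑ i, tr (x K i * partialDeriv i (toAss K n (u i)))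

/-- The projection of `ass_n` to its homogeneous part of degree `k`. -/
def assComp (k : ℕ) : Ass K n →ₗ[K] Ass K n :=
  onWords fun l => if l.length = k then word K l else 0

theorem assComp_comm (k : ℕ) (a b : Ass K n) : assComp k (a * b - b * a) ∈ commSpan K n := by
  refine word_induction (P := fun a => assComp k (a * b - b * a) ∈ commSpan K n) a
    (fun l => ?_) (by simp) (fun a₁ a₂ h₁ h₂ => ?_) (fun t a h => ?_)
  · refine word_induction
      (P := fun b => assComp k (word K l * b - b * word K l) ∈ commSpan K n) b
      (fun m => ?_) (by simp) (fun b₁ b₂ h₁ h₂ => ?_) (fun t b h => ?_)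
    · rw [map_sub, word_mul, word_mul, assComp, onWords_word, onWords_word, List.length_append,
        List.length_append, add_comm m.length]
      split_ifs
      · rw [← word_mul, ← word_mul]
        exact Submodule.subset_span ⟨_, _, rfl⟩
      · simp
    · have e : word K l * (b₁ + b₂) - (b₁ + b₂) * word K l
          = (word K l * b₁ - b₁ * word K l) + (word K l * b₂ - b₂ * word K l) := by noncomm_ring
      rw [e, map_add]
      exact Submodule.add_mem _ h₁ h₂
    · rw [mul_smul_comm, smul_mul_assoc, ← smul_sub, map_smul]
      exact Submodule.smul_mem _ _ h
  · have e : (a₁ + a₂) * b - b * (a₁ + a₂) = (a₁ * b - b * a₁) + (a₂ * b - b * a₂) := by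
      noncomm_ring
    rw [e, map_add]
    exact Submodule.add_mem _ h₁ h₂
  · rw [mul_smul_comm, smul_mul_assoc, ← smul_sub, map_smul]
    exact Submodule.smul_mem _ _ h

/-- The projection of `tr_n` to its homogeneous part of degree `k`. -/
def trComp (k : ℕ) : Tr K n →ₗ[K] Tr K n :=
  (commSpan K n).mapQ (commSpan K n) (assComp k) (by
    refine Submodule.span_le.mpr ?_
    rintro _ ⟨a, b, rfl⟩
    exact assComp_comm k a b)

/-- The canonical map of `tr_n` to its degree completion `∏ k, (tr_n)_k`; an element of the
completion is written as the sequence of its homogeneous components. -/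
def toCompletion (t : Tr K n) : ℕ → Tr K n := fun k => trComp k t

/-- `|f(a)| = ∑ k, f_k |a^k|` in the degree completion of `tr_n`, for a power series
`f = ∑ k, f_k s^k` and an element `a` of degree one. -/
def trSeries (f : PowerSeries K) (a : Ass K n) : ℕ → Tr K n :=
  fun k => PowerSeries.coeff k f • tr (a ^ k)

variable (K n)

/-- The degree one elements `x_0, x_1, …, x_n` of `ass_n`, where `x_0 = x_1 + ⋯ + x_n`. -/
def xExt : Fin (n + 1) → Ass K n := Fin.cons (∑ i, x K i) (x K)

/-- The Kashiwara-Vergne Lie algebra `krv_n`: the special derivations `ũ` with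
`div(ũ) = ∑_{i=0}^n |f_i(x_i)|` for some formal power series `f_0, …, f_n`. -/
def krv : Set (Tder K n) :=
  {u | u ∈ sder K n ∧ ∃ f : Fin (n + 1) → PowerSeries K,
    toCompletion (divergence u) = ∑ i, trSeries (f i) (xExt K n i)}

end KV

end

noncomputable section

namespace KV

variable {K : Type*} [Field K] {n : ℕ}

/-! Write `U_i` for `u_i` seen in `ass_n`. Since `ũ` is special, `v = ∑ x_i U_i = ∑ U_i x_i`. So `v`
is invariant under cyclic rotation of words, and removing `x_i` from either end of `v` gives `U_i`.
Contracting the first two letters of `v` therefore gives `div(ũ)` in `tr_n`. By rotation invariance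
each of the `k` adjacent pairs in degree `k + 1` contributes equally, so `|μ(v)|_k = -k div(ũ)_k`,
where `μ` is `muGr`.

On the other hand, the product rules for `μ` turn the hypothesis into `[x_i, μ(U_i) - ∂_i U_i] =
[x_i, c]`, so `μ(U_i) - ∂_i U_i = c - p_i(x_i)` by the centralizer theorem
`exists_aeval_of_commute`. Computing `μ(v)` from the two expressions for `v` gives `x_0 c - ∑ x_i
p_i(x_i)` and `c x_0 - ∑ x_i p_i(x_i)`. Hence `c` commutes with `x_0` and `c = q(x_0)`. Comparing
both values of `|μ(v)|` and dividing by `k` yields the power series. -/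

theorem x_mul_word (i : Fin n) (l : List (Fin n)) : x K i * word K l = word K (i :: l) := by
  simp [word]

theorem word_mul_x (i : Fin n) (l : List (Fin n)) : word K l * x K i = word K (l ++ [i]) := by
  simp [word]

theorem word_nil : word K ([] : List (Fin n)) = 1 := by
  simp [word]

/-- Two linear maps that agree on words are equal. -/
theorem linearMap_ext_word {M : Type*} [AddCommGroup M] [Module K M] {f g : Ass K n →ₗ[K] M}
    (h : ∀ l, f (word K l) = g (word K l)) : f = g := by
  refine (FreeAlgebra.basisFreeMonoid K (Fin n)).ext fun w => ?_
  rw [basis_eq_word, h]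

/-! ### Removing letters at either end of a word -/

/-- Removes an initial letter `x_i` and kills the words that do not begin with `x_i`. -/
def leftDeriv (i : Fin n) : Ass K n →ₗ[K] Ass K n :=
  onWords fun l => if l.head? = some i then word K l.tail else 0

/-- The constant term. -/
def augmentation : Ass K n →ₗ[K] K :=
  onWords fun l => if l = [] then 1 else 0

theorem augmentation_word (l : List (Fin n)) :
    augmentation (word K l) = if l = [] then 1 else 0 := onWords_word _ _

theorem leftDeriv_word (i : Fin n) (l : List (Fin n)) :
    leftDeriv i (word K l) = if l.head? = some i then word K l.tail else 0 := onWords_word _ _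

theorem partialDeriv_word (i : Fin n) (l : List (Fin n)) :
    partialDeriv i (word K l) = if l.getLast? = some i then word K l.dropLast else 0 :=
  onWords_word _ _

theorem leftDeriv_x_mul (i j : Fin n) (a : Ass K n) :
    leftDeriv i (x K j * a) = if j = i then a else 0 := by
  have : leftDeriv i ∘ₗ LinearMap.mulLeft K (x K j)
      = if j = i then LinearMap.id else (0 : Ass K n →ₗ[K] Ass K n) := by
    refine linearMap_ext_word fun l => ?_
    simp only [LinearMap.comp_apply, LinearMap.mulLeft_apply, x_mul_word, leftDeriv_word]
    split_ifs <;> simp_all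
  have h := LinearMap.congr_fun this a
  simp only [LinearMap.comp_apply, LinearMap.mulLeft_apply] at h
  rw [h]
  split_ifs <;> rfl

theorem partialDeriv_mul_x (i j : Fin n) (a : Ass K n) :
    partialDeriv i (a * x K j) = if j = i then a else 0 := by
  have : partialDeriv i ∘ₗ LinearMap.mulRight K (x K j)
      = if j = i then LinearMap.id else (0 : Ass K n →ₗ[K] Ass K n) := by
    refine linearMap_ext_word fun l => ?_
    simp only [LinearMap.comp_apply, LinearMap.mulRight_apply, word_mul_x, partialDeriv_word]
    split_ifs <;> simp_all
  have h := LinearMap.congr_fun this a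
  simp only [LinearMap.comp_apply, LinearMap.mulRight_apply] at h
  rw [h]
  split_ifs <;> rfl

/-- Appending a letter changes the initial letter only of the empty word, hence the correction by
the constant term. -/
theorem leftDeriv_mul_x (i j : Fin n) (a : Ass K n) :
    leftDeriv i (a * x K j)
      = leftDeriv i a * x K j + if j = i then algebraMap K _ (augmentation a) else 0 := by
  induction a using word_induction with
  | hw l =>
    rw [word_mul_x, leftDeriv_word, leftDeriv_word, augmentation_word]
    cases l with
    | nil => simp [word_nil]
    | cons b l =>
      simp only [List.cons_append, List.head?_cons, List.tail_cons, reduceCtorEq, if_false,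
        map_zero, ite_self, add_zero]
      split_ifs <;> simp [word_mul_x]
  | h0 => simp
  | hadd a b ha hb =>
    rw [add_mul, map_add, ha, hb, map_add, map_add, map_add]
    split_ifs
    · noncomm_ring
    · noncomm_ring
  | hsmul t a ha =>
    rw [smul_mul_assoc, map_smul, ha, map_smul, map_smul, smul_mul_assoc, smul_add]
    split_ifs
    · rw [smul_eq_mul, map_mul, ← Algebra.smul_def]
    · rw [smul_zero]

theorem partialDeriv_x_mul (i j : Fin n) (a : Ass K n) :
    partialDeriv i (x K j * a)
      = x K j * partialDeriv i a + if j = i then algebraMap K _ (augmentation a) else 0 := by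
  induction a using word_induction with
  | hw l =>
    rw [x_mul_word, partialDeriv_word, partialDeriv_word, augmentation_word]
    cases l with
    | nil => simp [word_nil]
    | cons b l =>
      simp only [List.getLast?_cons_cons, List.dropLast_cons_cons, reduceCtorEq, if_false,
        map_zero, ite_self, add_zero, mul_ite, mul_zero, x_mul_word]
  | h0 => simp
  | hadd a b ha hb =>
    rw [mul_add, map_add, ha, hb, map_add, map_add, map_add]
    split_ifs
    · noncomm_ring
    · noncomm_ring
  | hsmul t a ha =>
    rw [mul_smul_comm, map_smul, ha, map_smul, map_smul, mul_smul_comm, smul_add]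
    split_ifs
    · rw [smul_eq_mul, map_mul, ← Algebra.smul_def]
    · rw [smul_zero]

/-- Induction on the number of letters, adding letters on the left. -/
theorem x_mul_induction {P : Ass K n → Prop} (a : Ass K n) (h1 : P 1)
    (hx : ∀ i a, P a → P (x K i * a)) (h0 : P 0)
    (hadd : ∀ a b, P a → P b → P (a + b)) (hsmul : ∀ (t : K) a, P a → P (t • a)) : P a := by
  refine word_induction a (fun l => ?_) h0 hadd hsmul
  induction l with
  | nil => rwa [word_nil]
  | cons i l ih => rw [← x_mul_word]; exact hx i _ ih

theorem leftDeriv_one (i : Fin n) : leftDeriv i (1 : Ass K n) = 0 := by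
  rw [← word_nil, leftDeriv_word]; simp

theorem partialDeriv_one (i : Fin n) : partialDeriv i (1 : Ass K n) = 0 := by
  rw [← word_nil, partialDeriv_word]; simp

theorem leftDeriv_algebraMap (i : Fin n) (t : K) : leftDeriv i (algebraMap K (Ass K n) t) = 0 := by
  rw [Algebra.algebraMap_eq_smul_one, map_smul, leftDeriv_one, smul_zero]

/-- The two operators act at opposite ends of a word; on a single letter both composites vanish. -/
theorem leftDeriv_partialDeriv (i j : Fin n) (a : Ass K n) :
    leftDeriv i (partialDeriv j a) = partialDeriv j (leftDeriv i a) := by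
  induction a using x_mul_induction with
  | h1 => simp [leftDeriv_one, partialDeriv_one]
  | h0 => simp
  | hadd a b ha hb => simp only [map_add, ha, hb]
  | hsmul t a ha => simp only [map_smul, ha]
  | hx k a =>
  rw [partialDeriv_x_mul, map_add, leftDeriv_x_mul, leftDeriv_x_mul]
  split_ifs <;> simp [leftDeriv_algebraMap]

/-! ### Product rules for `muGr` -/

theorem muGr_word (l : List (Fin n)) : muGr (word K l) = -∑ j : Fin (l.length - 1),
    word K (l.take j) * frakz K (l[j.1]'(by omega)) (l[j.1 + 1]'(by omega)) *
      word K (l.drop (j + 2)) := onWords_word _ _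

theorem muGr_one : muGr (1 : Ass K n) = 0 := by
  rw [← word_nil, muGr_word]; simp

/-- Prepending a letter creates exactly one new adjacent pair, which contributes only if the next
letter is also `x_i`. -/
theorem muGr_x_mul (i : Fin n) (a : Ass K n) :
    muGr (x K i * a) = x K i * muGr a - x K i * leftDeriv i a := by
  induction a using word_induction with
  | h0 => simp
  | hadd a b ha hb => simp only [mul_add, map_add, ha, hb]; abel
  | hsmul t a ha => simp only [mul_smul_comm, map_smul, ha, smul_sub]
  | hw l =>
  rw [x_mul_word, muGr_word, muGr_word, leftDeriv_word]
  cases l with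
  | nil => simp
  | cons b l =>
    have : ∑ j : Fin ((i :: b :: l).length - 1), word K ((i :: b :: l).take j) *
          frakz K ((i :: b :: l)[j.1]'(by omega)) ((i :: b :: l)[j.1 + 1]'(by omega)) *
          word K ((i :: b :: l).drop (j + 2))
        = frakz K i b * word K l + x K i * ∑ j : Fin ((b :: l).length - 1),
          word K ((b :: l).take j) * frakz K ((b :: l)[j.1]'(by omega))
            ((b :: l)[j.1 + 1]'(by omega)) * word K ((b :: l).drop (j + 2)) := by
      refine (Fin.sum_univ_succ (n := l.length) _).trans ?_
      rw [Finset.mul_sum]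
      congr 1
      · simp [word_nil]
      · refine Finset.sum_congr rfl fun j _ => ?_
        simp only [Fin.val_succ, List.take_succ_cons, List.getElem_cons_succ, ← x_mul_word,
          mul_assoc]
        rfl
    rw [this]
    by_cases h : i = b
    · subst h; simp [frakz]; abel
    · simp [frakz, h, Ne.symm h]

theorem muGr_mul_x (i : Fin n) (a : Ass K n) :
    muGr (a * x K i) = muGr a * x K i - partialDeriv i a * x K i := by
  induction a using x_mul_induction with
  | h0 => simp
  | hadd a b ha hb => simp only [add_mul, map_add, ha, hb]; abel
  | hsmul t a ha => simp only [smul_mul_assoc, map_smul, ha, smul_sub]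
  | h1 =>
    have h := muGr_x_mul (K := K) i 1
    rw [muGr_one, leftDeriv_one, mul_one] at h
    rw [one_mul, h, muGr_one, partialDeriv_one]; simp
  | hx k a h =>
    rw [mul_assoc, muGr_x_mul, h, leftDeriv_mul_x, muGr_x_mul, partialDeriv_x_mul]
    by_cases hk : i = k
    · subst hk
      simp only [if_true, mul_sub, sub_mul, mul_add, add_mul, mul_assoc]
      rw [← Algebra.commutes (augmentation a) (x K i)]
      abel
    · simp only [if_neg hk, if_neg (Ne.symm hk), mul_sub, sub_mul, mul_add, add_mul, mul_assoc,
        mul_zero, zero_mul]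
      abel

/-! ## Centralizers of elements of degree one -/

/-- Local nilpotence replaces degree as the induction parameter for the centralizer theorem. -/
theorem exists_leftDeriv_pow_eq_zero (i : Fin n) (a : Ass K n) :
    ∃ N : ℕ, ((leftDeriv i : Ass K n →ₗ[K] Ass K n) ^ N) a = 0 := by
  induction a using word_induction with
  | h0 => exact ⟨0, by simp⟩
  | hw l =>
    induction l with
    | nil => exact ⟨1, by rw [pow_one, word_nil, leftDeriv_one]⟩
    | cons b l ih =>
      obtain ⟨N, hN⟩ := ih
      refine ⟨N + 1, ?_⟩
      rw [pow_succ, Module.End.mul_apply, ← x_mul_word, leftDeriv_x_mul]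
      split_ifs
      · exact hN
      · simp
  | hadd a b ha hb =>
    obtain ⟨N, hN⟩ := ha
    obtain ⟨M, hM⟩ := hb
    refine ⟨M + N, ?_⟩
    rw [map_add]
    nth_rewrite 1 [pow_add]
    rw [add_comm M N, pow_add, Module.End.mul_apply, Module.End.mul_apply, hN, hM]
    simp
  | hsmul t a ha =>
    obtain ⟨N, hN⟩ := ha
    exact ⟨N, by rw [map_smul, hN, smul_zero]⟩

/-- The centralizer of `a = ∑ j, t_j x_j`, where `t_i = 1` for some `i`, is `K[a]`. -/
theorem exists_aeval_of_commute {t : Fin n → K} {i : Fin n} (hi : t i = 1) {c : Ass K n}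
    (h : (∑ j, t j • x K j) * c = c * ∑ j, t j • x K j) :
    ∃ p : Polynomial K, c = Polynomial.aeval (∑ j, t j • x K j) p := by
  obtain ⟨N, hN⟩ := exists_leftDeriv_pow_eq_zero i c
  set a : Ass K n := ∑ j, t j • x K j with ha
  have left (b : Ass K n) : leftDeriv i (a * b) = b := by
    simp [ha, Finset.sum_mul, leftDeriv_x_mul, hi]
  have right (b : Ass K n) :
      leftDeriv i (b * a) = leftDeriv i b * a + algebraMap K _ (augmentation b) := by
    simp [ha, Finset.mul_sum, leftDeriv_mul_x, hi, Finset.sum_add_distrib]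
  have cancel {b b' : Ass K n} (e : b * a = b' * a) : b = b' := by
    have e' := congrArg (partialDeriv i) e
    simpa [ha, Finset.mul_sum, partialDeriv_mul_x, hi] using e'
  induction N generalizing c with
  | zero => exact ⟨0, by simpa using hN⟩
  | succ N ih =>
    -- Remove the initial letter from `a c = c a`: the left side returns `c`, so `c` is a right
    -- multiple of `a` up to a constant.
    have e : c = leftDeriv i c * a + algebraMap K _ (augmentation c) := by
      rw [← right, ← h, left]
    -- The quotient still commutes with `a`: substitute `e` into `a c = c a`, drop the constant term
    -- and cancel `a` on the right.
    have hcomm : a * leftDeriv i c = leftDeriv i c * a := by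
      apply cancel
      have h' := h
      rw [e, mul_add, add_mul, Algebra.commutes] at h'
      rw [mul_assoc]
      exact add_right_cancel h'
    obtain ⟨p, hp⟩ := ih (by rwa [pow_succ, Module.End.mul_apply] at hN) hcomm
    refine ⟨p * Polynomial.X + Polynomial.C (augmentation c), ?_⟩
    rw [map_add, map_mul, Polynomial.aeval_X, Polynomial.aeval_C, ← hp]
    exact e

/-! ## Contraction of adjacent letters and cyclic rotation -/

theorem tr_mul_comm (a b : Ass K n) : tr (a * b) = tr (b * a) := by
  rw [← sub_eq_zero, ← map_sub]
  exact (Submodule.Quotient.mk_eq_zero _).mpr (Submodule.subset_span ⟨a, b, rfl⟩)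

theorem trComp_tr (k : ℕ) (a : Ass K n) : trComp k (tr a) = tr (assComp k a) := rfl

theorem assComp_word (k : ℕ) (l : List (Fin n)) :
    assComp k (word K l) = if l.length = k then word K l else 0 := onWords_word _ _

/-- The cyclic rotation of words, which moves the first letter to the end. -/
def rotation : Ass K n →ₗ[K] Ass K n := onWords fun l => word K (l.rotate 1)

theorem rotation_pow_word (j : ℕ) (l : List (Fin n)) :
    ((rotation : Ass K n →ₗ[K] Ass K n) ^ j) (word K l) = word K (l.rotate j) := by
  induction j with
  | zero => simp
  | succ j ih =>
    rw [pow_succ', Module.End.mul_apply, ih, rotation, onWords_word, List.rotate_rotate]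

theorem rotation_x_mul (i : Fin n) (a : Ass K n) : rotation (x K i * a) = a * x K i := by
  have : rotation ∘ₗ LinearMap.mulLeft K (x K i) = LinearMap.mulRight K (x K i) := by
    refine linearMap_ext_word fun l => ?_
    simp [x_mul_word, word_mul_x, rotation, onWords_word]
  exact LinearMap.congr_fun this a

/-- The cyclic word obtained by contracting the first two letters with `𝔷`. -/
def contraction : Ass K n →ₗ[K] Tr K n :=
  tr ∘ₗ ∑ i, LinearMap.mulLeft K (x K i) ∘ₗ leftDeriv i ∘ₗ leftDeriv i

theorem contraction_apply (a : Ass K n) :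
    contraction a = tr (∑ i, x K i * leftDeriv i (leftDeriv i a)) := by
  simp [contraction]

theorem contraction_word_cons_cons (i j : Fin n) (l : List (Fin n)) :
    contraction (word K (i :: j :: l)) = tr (frakz K i j * word K l) := by
  rw [contraction_apply, Finset.sum_eq_single i]
  · rw [← x_mul_word, leftDeriv_x_mul, if_pos rfl, ← x_mul_word, leftDeriv_x_mul, frakz]
    by_cases h : i = j
    · simp [h]
    · simp [h, Ne.symm h]
  · intro b _ hb
    rw [← x_mul_word, leftDeriv_x_mul, if_neg hb.symm]
    simp
  · simp

/-- Contraction lowers the degree by one and kills words with fewer than two letters. -/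
theorem trComp_contraction_word (k : ℕ) (l : List (Fin n)) :
    trComp k (contraction (word K l))
      = if l.length = k + 1 then contraction (word K l) else 0 := by
  match l with
  | [] => simp [contraction_apply, word_nil, leftDeriv_one]
  | [a] =>
    have : contraction (word K [a]) = 0 := by
      rw [← mul_one (word K [a]), word, List.map_singleton, List.prod_singleton,
        contraction_apply]
      simp [leftDeriv_x_mul, apply_ite, leftDeriv_one, -mul_one]
    simp [this]
  | a :: b :: l =>
    rw [contraction_word_cons_cons, frakz]
    by_cases h : a = b
    · simp only [h, if_true, trComp_tr, x_mul_word, assComp_word, List.length_cons,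
        Nat.add_right_cancel_iff]
      split_ifs <;> simp
    · simp [h]

/-- In `tr_n`, contracting an inner pair amounts to rotating it to the front first. The pair made of
the last and first letters is not adjacent in the word, so one rotation is missing. -/
theorem tr_muGr_word (l : List (Fin n)) : tr (muGr (word K l))
    = -∑ j ∈ Finset.range (l.length - 1), contraction ((rotation ^ j) (word K l)) := by
  rw [muGr_word, map_neg, map_sum, ← Fin.sum_univ_eq_sum_range
    (fun j => contraction ((rotation ^ j) (word K l)))]
  congr 1
  refine Finset.sum_congr rfl fun j _ => ?_
  have hj := j.2
  rw [rotation_pow_word, List.rotate_eq_drop_append_take (by omega),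
    List.drop_eq_getElem_cons (i := j.1) (by omega),
    List.drop_eq_getElem_cons (i := j.1 + 1) (by omega),
    List.cons_append, List.cons_append, contraction_word_cons_cons, mul_assoc, tr_mul_comm,
    mul_assoc, word_mul]

/-- Fixing the degree makes the number of rotations independent of the word, so the formula extends
linearly. -/
theorem trComp_tr_muGr (k : ℕ) (a : Ass K n) : trComp k (tr (muGr a))
    = -∑ j ∈ Finset.range k, trComp k (contraction ((rotation ^ j) a)) := by
  have : trComp k ∘ₗ tr ∘ₗ muGr
      = -∑ j ∈ Finset.range k, trComp k ∘ₗ contraction ∘ₗ (rotation (K := K) (n := n) ^ j) := by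
    refine linearMap_ext_word fun l => ?_
    simp only [LinearMap.comp_apply, LinearMap.neg_apply, LinearMap.sum_apply, tr_muGr_word,
      map_neg, map_sum]
    simp only [rotation_pow_word, trComp_contraction_word, List.length_rotate]
    by_cases h : l.length = k + 1
    · simp [h]
    · simp [h]
  simpa using LinearMap.congr_fun this a

/-- On rotation invariant elements, `|μ^f_gr|` is a multiple of the contraction in each degree. -/
theorem trComp_tr_muGr_of_rotation_eq (k : ℕ) {a : Ass K n} (ha : rotation a = a) :
    trComp k (tr (muGr a)) = -((k : K) • trComp k (contraction a)) := by
  have h (j : ℕ) : (rotation ^ j) a = a := by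
    induction j with
    | zero => simp
    | succ j ih => rw [pow_succ, Module.End.mul_apply, ha, ih]
  simp [trComp_tr_muGr, h, Nat.cast_smul_eq_nsmul]

/-! ## Homogeneous components of polynomials in an element of degree one -/

theorem assComp_x_mul (k : ℕ) (i : Fin n) (a : Ass K n) :
    assComp k (x K i * a) = if k = 0 then 0 else x K i * assComp (k - 1) a := by
  induction a using word_induction with
  | h0 => simp
  | hadd a b ha hb =>
    rw [mul_add, map_add, ha, hb, map_add, mul_add]
    split_ifs <;> simp
  | hsmul t a ha =>
    rw [mul_smul_comm, map_smul, ha, map_smul, mul_smul_comm]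
    split_ifs <;> simp
  | hw l =>
    rw [x_mul_word, assComp_word, assComp_word]
    cases k <;> simp [x_mul_word]

theorem assComp_pow (t : Fin n → K) (k m : ℕ) : assComp k ((∑ i, t i • x K i) ^ m)
    = if m = k then (∑ i, t i • x K i) ^ m else 0 := by
  induction m generalizing k with
  | zero =>
    rw [pow_zero, ← word_nil, assComp_word]
    simp
  | succ m ih =>
    rw [pow_succ', Finset.sum_mul, map_sum]
    simp only [smul_mul_assoc, map_smul, assComp_x_mul, ih]
    cases k with
    | zero => simp
    | succ k => simp [Finset.sum_ite_irrel]

theorem trComp_tr_aeval (t : Fin n → K) (k : ℕ) (p : Polynomial K) :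
    trComp k (tr (Polynomial.aeval (∑ i, t i • x K i) p))
      = p.coeff k • tr ((∑ i, t i • x K i) ^ k) := by
  rw [trComp_tr, Polynomial.aeval_eq_sum_range, map_sum]
  simp only [map_smul, assComp_pow, smul_ite, smul_zero]
  rw [Finset.sum_ite_eq']
  split_ifs with h
  · simp
  · rw [Polynomial.coeff_eq_zero_of_natDegree_lt (by simpa using h)]
    simp

/-! ### Special derivations inside `ass_n` and power series in characteristic zero -/

section
attribute [local instance] LieRing.ofAssociativeRing

theorem toAss_of (i : Fin n) : toAss K n (FreeLieAlgebra.of K i) = x K i := by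
  simp [toAss]

theorem toAss_rho_of (u : Tder K n) (i : Fin n) :
    toAss K n (rho u (FreeLieAlgebra.of K i))
      = x K i * toAss K n (u i) - toAss K n (u i) * x K i := by
  rw [rho_of, LieHom.map_lie, toAss_of, LieRing.of_associative_ring_bracket]

theorem sum_x_mul_eq_of_mem_sder {u : Tder K n} (hu : u ∈ sder K n) :
    ∑ i, x K i * toAss K n (u i) = ∑ i, toAss K n (u i) * x K i := by
  have h := congrArg (toAss K n) (show rho u (∑ i, FreeLieAlgebra.of K i) = 0 from hu)
  rw [map_sum, map_sum, map_zero] at h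
  simpa [toAss_rho_of, sub_eq_zero] using h

end

theorem x_eq_sum (i : Fin n) : x K i = ∑ j, (Pi.single i (1 : K) : Fin n → K) j • x K j := by
  simp [Pi.single_apply]

theorem sum_x_eq_sum : ∑ j, x K j = ∑ j : Fin n, (1 : Fin n → K) j • x K j := by
  simp

theorem exists_aeval_of_commute_x {i : Fin n} {c : Ass K n} (h : x K i * c = c * x K i) :
    ∃ p : Polynomial K, c = Polynomial.aeval (x K i) p := by
  rw [x_eq_sum] at h ⊢
  exact exists_aeval_of_commute (Pi.single_eq_same i 1) h

theorem exists_aeval_of_commute_sum_x [NeZero n] {c : Ass K n}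
    (h : (∑ i, x K i) * c = c * ∑ i, x K i) :
    ∃ p : Polynomial K, c = Polynomial.aeval (∑ i, x K i) p := by
  rw [sum_x_eq_sum] at h ⊢
  exact exists_aeval_of_commute (i := 0) rfl h

theorem trComp_tr_x_mul_aeval (i : Fin n) (k : ℕ) (p : Polynomial K) :
    trComp k (tr (x K i * Polynomial.aeval (x K i) p))
      = (Polynomial.X * p).coeff k • tr (x K i ^ k) := by
  have h := trComp_tr_aeval (Pi.single i (1 : K)) k (Polynomial.X * p)
  rwa [← x_eq_sum, map_mul, Polynomial.aeval_X] at h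

theorem trComp_tr_sum_x_mul_aeval (k : ℕ) (p : Polynomial K) :
    trComp k (tr ((∑ i : Fin n, x K i) * Polynomial.aeval (∑ i, x K i) p))
      = (Polynomial.X * p).coeff k • tr ((∑ i, x K i) ^ k) := by
  have h := trComp_tr_aeval (1 : Fin n → K) k (Polynomial.X * p)
  rwa [← sum_x_eq_sum, map_mul, Polynomial.aeval_X] at h

theorem trComp_zero_divergence (u : Tder K n) : trComp 0 (divergence u) = 0 := by
  simp [divergence, trComp_tr, assComp_x_mul]

/-- In characteristic zero, `t ∈ tr_n` has the form `∑ i, |f_i(x_i)|` if its constant term vanishes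
and `k t_k` has this form in each degree `k`. -/
theorem exists_trSeries_of_smul [CharZero K] {t : Tr K n} (h0 : trComp 0 t = 0)
    (g : Fin (n + 1) → ℕ → K)
    (h : ∀ k : ℕ, (k : K) • trComp k t = ∑ i, g i k • tr (xExt K n i ^ k)) :
    ∃ f : Fin (n + 1) → PowerSeries K, toCompletion t = ∑ i, trSeries (f i) (xExt K n i) := by
  -- For `k = 0` the inverse is `0` by convention, which is harmless because the constant term of
  -- `t` vanishes.
  refine ⟨fun i => PowerSeries.mk fun k => (k : K)⁻¹ * g i k, funext fun k => ?_⟩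
  rw [Finset.sum_apply]
  simp only [toCompletion, trSeries, PowerSeries.coeff_mk, mul_smul]
  rw [← Finset.smul_sum, ← h]
  rcases eq_or_ne k 0 with rfl | hk
  · simp [h0]
  · rw [inv_smul_smul₀ (Nat.cast_ne_zero.mpr hk)]

end KV

end

/-! ### The proposition -/

theorem proposition6p2 {K : Type*} [Field K] [CharZero K] {n : ℕ}
    (u : KV.Tder K n) (hu : u ∈ KV.sder K n)
    (hc : ∃ c : KV.Ass K n, ∀ i : Fin n,
      KV.muGr (KV.toAss K n (KV.rho u (FreeLieAlgebra.of K i))) =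
        KV.x K i * c - c * KV.x K i) :
    u ∈ KV.krv K n := by
  open KV in
  refine ⟨hu, ?_⟩
  -- The centralizer theorem for `x_0` needs a generator occurring in it, so `n = 0` is treated
  -- apart.
  rcases Nat.eq_zero_or_pos n with rfl | hn
  · exact ⟨0, by ext k; simp [toCompletion, divergence, trSeries]⟩
  have : NeZero n := ⟨hn.ne'⟩
  obtain ⟨c, hc⟩ := hc
  set U : Fin n → Ass K n := fun i => toAss K n (u i) with hU
  set v : Ass K n := ∑ i, x K i * U i with hv
  have hv' : v = ∑ i, U i * x K i := sum_x_mul_eq_of_mem_sder hu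
  have hrot : rotation v = v := by
    conv_rhs => rw [hv']
    simp [hv, rotation_x_mul]
  have hl (i : Fin n) : leftDeriv i v = U i := by simp [hv, leftDeriv_x_mul]
  have hr (i : Fin n) : partialDeriv i v = U i := by simp [hv', partialDeriv_mul_x]
  -- Both sides remove an `x_i` from each end of `v`.
  have hlr (i : Fin n) : leftDeriv i (U i) = partialDeriv i (U i) := by
    conv_lhs => rw [← hr]
    rw [leftDeriv_partialDeriv, hl]
  have hdiv : contraction v = divergence u := by
    rw [contraction_apply, map_sum, divergence]
    exact Finset.sum_congr rfl fun i _ => by rw [hl, hlr]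
  have hcomm (i : Fin n) : x K i * (partialDeriv i (U i) - muGr (U i) + c)
      = (partialDeriv i (U i) - muGr (U i) + c) * x K i := by
    have h := hc i
    rw [toAss_rho_of, map_sub, muGr_x_mul, muGr_mul_x] at h
    change x K i * muGr (U i) - x K i * leftDeriv i (U i)
      - (muGr (U i) * x K i - partialDeriv i (U i) * x K i) = _ at h
    rw [hlr] at h
    simp only [mul_add, mul_sub, add_mul, sub_mul]
    rw [← sub_eq_zero] at h ⊢
    rw [← neg_eq_zero, ← h]
    abel
  choose p hp using fun i => exists_aeval_of_commute_x (hcomm i)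
  have hmu (i : Fin n) :
      muGr (U i) - partialDeriv i (U i) = c - Polynomial.aeval (x K i) (p i) := by
    rw [← hp]; abel
  have hmul : muGr v = (∑ i, x K i) * c - ∑ i, x K i * Polynomial.aeval (x K i) (p i) := by
    rw [hv, map_sum, Finset.sum_mul, ← Finset.sum_sub_distrib]
    refine Finset.sum_congr rfl fun i _ => ?_
    rw [muGr_x_mul, hlr, ← mul_sub, hmu, mul_sub]
  have hmur : muGr v = c * (∑ i, x K i) - ∑ i, x K i * Polynomial.aeval (x K i) (p i) := by
    rw [hv', map_sum, Finset.mul_sum, ← Finset.sum_sub_distrib]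
    refine Finset.sum_congr rfl fun i _ => ?_
    rw [muGr_mul_x, ← sub_mul, hmu, sub_mul]
    -- Here `p_i(x_i)` stands to the left of `x_i`; the two commute.
    congr 1
    have h := congrArg (Polynomial.aeval (x K i)) (mul_comm (p i) Polynomial.X)
    simpa using h
  -- The polynomial sums in the two values of `muGr v` cancel, leaving `x_0 c = c x_0`.
  obtain ⟨q, rfl⟩ := exists_aeval_of_commute_sum_x (sub_left_injective (hmul.symm.trans hmur))
  refine exists_trSeries_of_smul (trComp_zero_divergence u)
    -- The signs are opposite to those in `muGr v`, whose trace is `-k` times the divergence in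
    -- degree `k`.
    (Fin.cons (fun k => -(Polynomial.X * q).coeff k) fun i k => (Polynomial.X * p i).coeff k)
    fun k => ?_
  have h := trComp_tr_muGr_of_rotation_eq k hrot
  rw [hdiv, hmul, map_sub, map_sub, map_sum, map_sum, trComp_tr_sum_x_mul_aeval] at h
  simp only [trComp_tr_x_mul_aeval] at h
  rw [← neg_eq_iff_eq_neg.mpr h, Fin.sum_univ_succ]
  simp only [xExt, Fin.cons_zero, Fin.cons_succ, neg_smul]
  abel
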